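/- Let $T>0$, let $(\Omega,\mathcal F,\mathbb F=(\mathcal F_t)_{t\in[0,T]},P)$ be a filtered probability space with $\mathcal F_0$ trivial (every $A\in\mathcal F_0$ has $P(A)\in\{0,1\}$), and let $X=(X_t)_{t\in[0,T]}$ be a real-valued adapted process with continuous paths. For $h\in(0,T)$, $\delta,c>0$ and a stopping time $\tau$ with values in $[0,T-h)$, put $L_t=X_{\tau+t}-X_\tau$ and $$F^0_X(\tau,h,\delta,c)=\Big\{\sup_{t\in[0,T-\tau)}|L_t|<\delta\Big\},$$ $$F^1_X(\tau,h,\delta,c)=\Big\{\sup_{t\in[0,h]}L_t<\delta\Big\}\cap\Big\{\sup_{t\in[h,T-\tau)}L_t<-c\Big\},$$ $$F^{-1}_X(\tau,h,\delta,c)=\Big\{\inf_{t\in[0,h]}L_t>-\delta\Big\}\cap\Big\{\inf_{t\in[h,T-\tau)}L_t>c\Big\}.$$ Let $\epsilon_0>0$ and suppose that for every $h\in(0,T)$, every stopping time $\tau$ with values in $[0,T-h)$ and every $j\in\{-1,0,1\}$, $$P\big(F^j_X(\tau,h,\log(1+\epsilon_0),\log(1+\epsilon_0))\,\big|\,\mathcal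 F_\tau\big)>0\quad\text{a.s.}$$ Then $Y_t=e^{X_t}$ admits an $\epsilon$-consistent price system on $[0,T]$ with $\epsilon=(1+\epsilon_0)^3-1$: there exist a probability measure $\tilde P$ equivalent to $P$ and an $(\mathbb F,\tilde P)$-martingale $(\tilde Y_t)_{t\in[0,T]}$ such that, almost surely, $(1+\epsilon)^{-1}Y_t\le\tilde Y_t\le(1+\epsilon)Y_t$ for all $t\in[0,T]$. -/

import Mathlib

open MeasureTheory ProbabilityTheory

namespace CPS

/-- The increment `L_t = X_{τ+t} - X_τ` of the path `ω` after the random time `τ`, for a process `X`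
indexed by `[0, T]`. It is only ever evaluated at times `t` with `0 ≤ t ≤ T - τ ω`, where the
extension of the path to all of `ℝ` plays no role. -/
noncomputable def increment {Ω : Type*} {T : ℝ} (hT : 0 ≤ T)
    (X : Set.Icc (0 : ℝ) T → Ω → ℝ) (τ : Ω → Set.Icc (0 : ℝ) T) (ω : Ω) (t : ℝ) : ℝ :=
  Set.IccExtend hT (fun s => X s ω) ((τ ω : ℝ) + t) - X (τ ω) ω

/-- The events `F_X^j(τ, h, δ, c)`, `j ∈ {-1, 0, 1}`:
* `j = 0`: `sup_{t ∈ [0, T - τ)} |L_t| < δ`;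
* `j = 1`: `sup_{t ∈ [0, h]} L_t < δ` and `sup_{t ∈ [h, T - τ)} L_t < -c`;
* `j = -1`: `inf_{t ∈ [0, h]} L_t > -δ` and `inf_{t ∈ [h, T - τ)} L_t > c`. -/
noncomputable def event {Ω : Type*} {T : ℝ} (hT : 0 ≤ T)
    (X : Set.Icc (0 : ℝ) T → Ω → ℝ) (τ : Ω → Set.Icc (0 : ℝ) T) (h δ c : ℝ) :
    SignType → Set Ω
  | .zero => {ω | sSup ((fun t => |increment hT X τ ω t|) '' Set.Ico 0 (T - τ ω)) < δ}
  | .pos => {ω | sSup (increment hT X τ ω '' Set.Icc 0 h) < δ} ∩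
      {ω | sSup (increment hT X τ ω '' Set.Ico h (T - τ ω)) < -c}
  | .neg => {ω | sInf (increment hT X τ ω '' Set.Icc 0 h) > -δ} ∩
      {ω | sInf (increment hT X τ ω '' Set.Ico h (T - τ ω)) > c}

/-- A (strictly positive, adapted) process `Y` admits an `ε`-consistent price system: there are a
probability measure `Q` equivalent to `P` and an `(𝓕, Q)`-martingale `M` such that, almost surely,
`(1 + ε)⁻¹ Y_t ≤ M_t ≤ (1 + ε) Y_t` for all `t`. -/
def AdmitsCPS {Ω ι : Type*} [Preorder ι] {m : MeasurableSpace Ω} (𝓕 : Filtration ι m)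
    (P : Measure Ω) (ε : ℝ) (Y : ι → Ω → ℝ) : Prop :=
  ∃ (Q : Measure Ω) (M : ι → Ω → ℝ), IsProbabilityMeasure Q ∧ Q ≪ P ∧ P ≪ Q ∧
    Martingale M 𝓕 Q ∧
    ∀ᵐ ω ∂P, ∀ t, (1 + ε)⁻¹ * Y t ω ≤ M t ω ∧ M t ω ≤ (1 + ε) * Y t ω

end CPS

open scoped ENNReal

namespace CPS

section Discrete

open Filter Topology

variable {Ω : Type*} {G m : MeasurableSpace Ω}

/-- If every `G`-measurable non-null part of `S` meets `E ⊆ S` in a non-null set, then the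
conditional probability of `E` given `G` can be divided out on `S`. -/
theorem exists_inverse_condProb (hG : G ≤ m) (P : Measure Ω)
    [IsFiniteMeasure P] {S E : Set Ω} (hS : MeasurableSet[G] S) (hE : MeasurableSet E)
    (hES : E ⊆ S)
    (hpos : ∀ A, MeasurableSet[G] A → A ⊆ S → P (A ∩ E) = 0 → P A = 0) :
    ∃ f : Ω → ℝ≥0∞, Measurable[G] f ∧ (∀ ω, f ω ≠ 0) ∧ (∀ ω, f ω ≠ ∞) ∧
      ∀ W : Ω → ℝ≥0∞, Measurable[G] W → ∫⁻ ω in E, W ω * f ω ∂P = ∫⁻ ω in S, W ω ∂P := by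
  classical
  set ν : @Measure Ω G := (P.restrict E).trim hG with hν
  set ρ : @Measure Ω G := P.trim hG with hρ
  have hac : ν ≪ ρ := by
    refine Measure.AbsolutelyContinuous.mk fun s hs h0 => ?_
    rw [hρ, trim_measurableSet_eq hG hs] at h0
    rw [hν, trim_measurableSet_eq hG hs, Measure.restrict_apply (hG _ hs)]
    exact measure_mono_null Set.inter_subset_left h0
  set p : Ω → ℝ≥0∞ := @Measure.rnDeriv Ω G ν ρ with hp
  have hpm : Measurable[G] p := @Measure.measurable_rnDeriv Ω G ν ρ
  have hwd : @Measure.withDensity Ω G ρ p = ν := @Measure.withDensity_rnDeriv_eq Ω G ν ρ _ hac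
  have key : ∀ V : Ω → ℝ≥0∞, Measurable[G] V →
      ∫⁻ ω in E, V ω ∂P = ∫⁻ ω, p ω * V ω ∂P := by
    intro V hV
    rw [← lintegral_trim hG hV, ← hν, ← hwd,
      @lintegral_withDensity_eq_lintegral_mul Ω G ρ p hpm V hV]
    exact lintegral_trim hG (hpm.mul hV)
  have hbad : P (S ∩ {ω | p ω = 0}) = 0 := by
    have hm0 : MeasurableSet[G] (S ∩ {ω | p ω = 0}) :=
      MeasurableSet.inter hS (hpm (measurableSet_singleton 0))
    refine hpos _ hm0 Set.inter_subset_left ?_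
    have h1 := key ((S ∩ {ω | p ω = 0}).indicator fun _ => 1)
      (Measurable.indicator (mβ := inferInstance) measurable_const hm0)
    rw [lintegral_indicator (hG _ hm0), setLIntegral_one, Measure.restrict_apply (hG _ hm0)] at h1
    rw [h1]
    refine (lintegral_congr fun ω => ?_).trans lintegral_zero
    by_cases h : ω ∈ S ∩ {ω | p ω = 0}
    · have : p ω = 0 := h.2
      simp [this]
    · simp [h]
  have htop : ∀ᵐ ω ∂P, p ω < ∞ :=
    ae_of_ae_trim hG (@Measure.rnDeriv_lt_top Ω G ν ρ _)
  set B : Set Ω := {ω | p ω ≠ 0} ∩ {ω | p ω ≠ ∞} with hB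
  have hBm : MeasurableSet[G] B :=
    MeasurableSet.inter (hpm (measurableSet_singleton 0).compl)
      (hpm (measurableSet_singleton ∞).compl)
  refine ⟨B.piecewise (fun ω => (p ω)⁻¹) (fun _ => 1),
    Measurable.piecewise hBm hpm.inv measurable_const, ?_, ?_, ?_⟩
  · intro ω
    by_cases h : ω ∈ B
    · simpa [h] using h.2
    · simp [h]
  · intro ω
    by_cases h : ω ∈ B
    · simpa [h] using h.1
    · simp [h]
  · intro W hW
    set f : Ω → ℝ≥0∞ := B.piecewise (fun ω => (p ω)⁻¹) (fun _ => 1) with hf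
    have hfm : Measurable[G] f := Measurable.piecewise hBm hpm.inv measurable_const
    have e1 : ∫⁻ ω in E, W ω * f ω ∂P = ∫⁻ ω in E, S.indicator (fun ω => W ω * f ω) ω ∂P := by
      refine setLIntegral_congr_fun hE fun ω hω => ?_
      simp [hES hω]
    rw [e1, key (S.indicator fun ω => W ω * f ω) (Measurable.indicator (Measurable.mul hW hfm) hS),
      ← lintegral_indicator (hG _ hS)]
    refine lintegral_congr_ae ?_
    have hb : ∀ᵐ ω ∂P, ω ∉ S ∩ {ω | p ω = 0} := measure_eq_zero_iff_ae_notMem.1 hbad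
    filter_upwards [hb, htop] with ω h1 h2
    by_cases hs : ω ∈ S
    · have h0 : p ω ≠ 0 := fun h => h1 ⟨hs, h⟩
      have hBω : ω ∈ B := ⟨h0, h2.ne⟩
      simp only [hs, Set.indicator_of_mem, hf, Set.piecewise_eq_of_mem _ _ _ hBω]
      rw [mul_comm (W ω), ← mul_assoc, ENNReal.mul_inv_cancel h0 h2.ne, one_mul]
    · simp [hs]

/-- A multiplicative process whose factors have conditional mean one, and which is frozen with
conditional probability `1/2` (after weighting) at each step, is closed by its limit. -/
theorem lintegral_mul_limit_eq (P : Measure Ω) (𝓖 : Filtration ℕ m) (S : ℕ → Set Ω)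
    (hS : ∀ n, MeasurableSet[𝓖 n] (S n)) (hSanti : Antitone S) (hSempty : ⋂ n, S n = ∅)
    (U V : ℕ → Ω → ℝ≥0∞) (L : Ω → ℝ≥0∞)
    (hU : ∀ n, Measurable[𝓖 n] (U n)) (hUV : ∀ n ω, U (n + 1) ω = U n ω * V n ω)
    (hL : ∀ n, ∀ ω ∉ S n, L ω = U n ω)
    (hmean : ∀ n (W : Ω → ℝ≥0∞), Measurable[𝓖 n] W → ∫⁻ ω, W ω * V n ω ∂P = ∫⁻ ω, W ω ∂P)
    (hhalf : ∀ n (W : Ω → ℝ≥0∞), Measurable[𝓖 n] W →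
      ∫⁻ ω in S (n + 1), W ω * V n ω ∂P = 2⁻¹ * ∫⁻ ω in S n, W ω ∂P)
    (n : ℕ) (W : Ω → ℝ≥0∞) (hW : Measurable[𝓖 n] W) (hfin : ∫⁻ ω, W ω * U n ω ∂P ≠ ∞) :
    ∫⁻ ω, W ω * L ω ∂P = ∫⁻ ω, W ω * U n ω ∂P := by
  have hW' : ∀ k, Measurable[𝓖 (n + k)] W := fun k => hW.mono (𝓖.mono (by omega)) le_rfl
  have h1 : ∀ k, ∫⁻ ω, W ω * U (n + k) ω ∂P = ∫⁻ ω, W ω * U n ω ∂P := by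
    intro k
    induction k with
    | zero => rfl
    | succ k ih =>
      have := hmean (n + k) _ ((hW' k).mul (hU (n + k)))
      simp only [Pi.mul_apply] at this
      rw [← ih, ← this, ← add_assoc]
      refine lintegral_congr fun ω => ?_
      rw [hUV, mul_assoc]
  have h2 : ∀ k, ∫⁻ ω in S (n + k), W ω * U (n + k) ω ∂P
      = 2⁻¹ ^ k * ∫⁻ ω in S n, W ω * U n ω ∂P := by
    intro k
    induction k with
    | zero => simp
    | succ k ih =>
      rw [pow_succ', mul_assoc, ← ih, ← add_assoc]
      have := hhalf (n + k) _ ((hW' k).mul (hU (n + k)))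
      simp only [Pi.mul_apply] at this
      rw [← this]
      refine lintegral_congr fun ω => ?_
      rw [hUV, mul_assoc]
  have h3 : ∀ k, ∫⁻ ω in (S (n + k))ᶜ, W ω * L ω ∂P
      + ∫⁻ ω in S (n + k), W ω * U (n + k) ω ∂P = ∫⁻ ω, W ω * U n ω ∂P := by
    intro k
    have hSm : MeasurableSet (S (n + k)) := 𝓖.le _ _ (hS (n + k))
    rw [← h1 k, ← lintegral_add_compl (μ := P) (fun ω => W ω * U (n + k) ω) hSm, add_comm]
    congr 1
    refine setLIntegral_congr_fun hSm.compl fun ω hω => ?_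
    simp only [hL _ ω hω]
  have t1 : Tendsto (fun k => ∫⁻ ω in (S (n + k))ᶜ, W ω * L ω ∂P) atTop
      (𝓝 (∫⁻ ω, W ω * L ω ∂P)) := by
    have hmono : Monotone fun k => (S (n + k))ᶜ := fun i j hij =>
      Set.compl_subset_compl.2 (hSanti (by omega))
    have hun : ⋃ k, (S (n + k))ᶜ = Set.univ := by
      rw [← Set.compl_iInter, Set.compl_univ_iff, Set.eq_empty_iff_forall_notMem]
      intro ω hω
      rw [Set.mem_iInter] at hω
      have : ω ∈ ⋂ n, S n := Set.mem_iInter.2 fun k => hSanti (by omega : k ≤ n + k) (hω k)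
      simp [hSempty] at this
    have := tendsto_measure_iUnion_atTop (μ := P.withDensity fun ω => W ω * L ω) hmono
    rw [hun, withDensity_apply _ MeasurableSet.univ, Measure.restrict_univ] at this
    refine this.congr fun k => ?_
    simp only [Function.comp]
    rw [withDensity_apply _ (𝓖.le _ _ (hS (n + k))).compl]
  have t2 : Tendsto (fun k => ∫⁻ ω in S (n + k), W ω * U (n + k) ω ∂P) atTop (𝓝 0) := by
    simp_rw [h2]
    have hc : ∫⁻ ω in S n, W ω * U n ω ∂P ≠ ∞ :=
      ne_top_of_le_ne_top hfin (setLIntegral_le_lintegral _ _)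
    have := ENNReal.Tendsto.mul_const (b := ∫⁻ ω in S n, W ω * U n ω ∂P)
      (ENNReal.tendsto_pow_atTop_nhds_zero_of_lt_one (r := 2⁻¹) (by simp)) (Or.inr hc)
    simpa using this
  have t3 := t1.add t2
  simp_rw [h3] at t3
  rw [add_zero] at t3
  exact tendsto_nhds_unique t3 tendsto_const_nhds

open Classical in
/-- The function equal to `g₁` on `A`, to `g₂` on `B`, to `g₀` on the rest of `S` and to `1`
elsewhere. -/
noncomputable def stepWeight (S A B : Set Ω) (g₀ g₁ g₂ : Ω → ℝ≥0∞) (ω : Ω) : ℝ≥0∞ :=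
  if ω ∈ A then g₁ ω else if ω ∈ B then g₂ ω else if ω ∈ S then g₀ ω else 1

theorem measurable_stepWeight {S A B : Set Ω} {g₀ g₁ g₂ : Ω → ℝ≥0∞}
    (hS : MeasurableSet S) (hA : MeasurableSet A) (hB : MeasurableSet B)
    (h₀ : Measurable g₀) (h₁ : Measurable g₁) (h₂ : Measurable g₂) :
    Measurable (stepWeight S A B g₀ g₁ g₂) :=
  Measurable.ite hA h₁ (Measurable.ite hB h₂ (Measurable.ite hS h₀ measurable_const))

theorem stepWeight_lintegral (P : Measure Ω) {S A B : Set Ω} (hS : MeasurableSet S)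
    (hA : MeasurableSet A) (hB : MeasurableSet B) (hAB : Disjoint A B) (hABS : A ∪ B ⊆ S)
    {f₀ f₁ f₂ W : Ω → ℝ≥0∞} (hW : Measurable W)
    (h₀m : Measurable f₀) (h₁m : Measurable f₁) (h₂m : Measurable f₂)
    (h₀ : ∫⁻ ω in S \ (A ∪ B), W ω * f₀ ω ∂P = ∫⁻ ω in S, W ω ∂P)
    (h₁ : ∫⁻ ω in A, W ω * f₁ ω ∂P = ∫⁻ ω in S, W ω ∂P)
    (h₂ : ∫⁻ ω in B, W ω * f₂ ω ∂P = ∫⁻ ω in S, W ω ∂P)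
    {c₁ c₂ : ℝ≥0∞} (hc : c₁ + c₂ = 2⁻¹) :
    ∫⁻ ω in A ∪ B, W ω * stepWeight S A B (fun ω => 2⁻¹ * f₀ ω) (fun ω => c₁ * f₁ ω)
        (fun ω => c₂ * f₂ ω) ω ∂P = 2⁻¹ * ∫⁻ ω in S, W ω ∂P ∧
    ∫⁻ ω, W ω * stepWeight S A B (fun ω => 2⁻¹ * f₀ ω) (fun ω => c₁ * f₁ ω)
        (fun ω => c₂ * f₂ ω) ω ∂P = ∫⁻ ω, W ω ∂P := by
  set V := stepWeight S A B (fun ω => 2⁻¹ * f₀ ω) (fun ω => c₁ * f₁ ω) (fun ω => c₂ * f₂ ω)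
  have e1 : ∫⁻ ω in A, W ω * V ω ∂P = c₁ * ∫⁻ ω in S, W ω ∂P := by
    rw [← h₁, ← lintegral_const_mul _ (f := fun ω => W ω * f₁ ω) (hW.mul h₁m)]
    refine setLIntegral_congr_fun hA fun ω hω => ?_
    simp only [V, stepWeight, hω, if_true]
    ring
  have e2 : ∫⁻ ω in B, W ω * V ω ∂P = c₂ * ∫⁻ ω in S, W ω ∂P := by
    rw [← h₂, ← lintegral_const_mul _ (f := fun ω => W ω * f₂ ω) (hW.mul h₂m)]
    refine setLIntegral_congr_fun hB fun ω hω => ?_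
    simp only [V, stepWeight, hω, if_true, Set.disjoint_right.1 hAB hω, if_false]
    ring
  have e0 : ∫⁻ ω in S \ (A ∪ B), W ω * V ω ∂P = 2⁻¹ * ∫⁻ ω in S, W ω ∂P := by
    rw [← h₀, ← lintegral_const_mul _ (f := fun ω => W ω * f₀ ω) (hW.mul h₀m)]
    refine setLIntegral_congr_fun (hS.diff (hA.union hB)) fun ω hω => ?_
    have h1 : ω ∉ A := fun h => hω.2 (Or.inl h)
    have h2 : ω ∉ B := fun h => hω.2 (Or.inr h)
    simp only [V, stepWeight, h1, h2, hω.1, if_true, if_false]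
    ring
  have e3 : ∫⁻ ω in Sᶜ, W ω * V ω ∂P = ∫⁻ ω in Sᶜ, W ω ∂P := by
    refine setLIntegral_congr_fun hS.compl fun ω hω => ?_
    have h1 : ω ∉ A := fun h => hω (hABS (Or.inl h))
    have h2 : ω ∉ B := fun h => hω (hABS (Or.inr h))
    have h3 : ω ∉ S := hω
    simp [V, stepWeight, h1, h2, h3]
  have e4 : ∫⁻ ω in A ∪ B, W ω * V ω ∂P = 2⁻¹ * ∫⁻ ω in S, W ω ∂P := by
    rw [lintegral_union hB hAB, e1, e2, ← add_mul, hc]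
  refine ⟨e4, ?_⟩
  have e5 : ∫⁻ ω in S, W ω * V ω ∂P = ∫⁻ ω in S, W ω ∂P := by
    have := lintegral_inter_add_sdiff (μ := P) (fun ω => W ω * V ω) S (hA.union hB)
    rw [Set.inter_eq_self_of_subset_right hABS, e4, e0, ← add_mul, ENNReal.inv_two_add_inv_two,
      one_mul] at this
    exact this.symm
  rw [← lintegral_add_compl _ hS, e5, e3, lintegral_add_compl _ hS]

/-- A geometric random walk with steps `l` and `l⁻¹`, which retires at some finite time and whose
next step is, while alive, not determined by the past, is closed as a martingale by its limit under
an equivalent probability measure. -/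
theorem exists_walk_measure (P : Measure Ω) [IsProbabilityMeasure P] (𝓖 : Filtration ℕ m)
    (S A B : ℕ → Set Ω) (hS : ∀ n, MeasurableSet[𝓖 n] (S n))
    (hA : ∀ n, MeasurableSet[𝓖 (n + 1)] (A n)) (hB : ∀ n, MeasurableSet[𝓖 (n + 1)] (B n))
    (hAB : ∀ n, Disjoint (A n) (B n)) (hABS : ∀ n, A n ∪ B n = S (n + 1))
    (hSS : ∀ n, S (n + 1) ⊆ S n) (hSempty : ⋂ n, S n = ∅)
    (hposA : ∀ n C, MeasurableSet[𝓖 n] C → C ⊆ S n → P (C ∩ A n) = 0 → P C = 0)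
    (hposB : ∀ n C, MeasurableSet[𝓖 n] C → C ⊆ S n → P (C ∩ B n) = 0 → P C = 0)
    (hposR : ∀ n C, MeasurableSet[𝓖 n] C → C ⊆ S n → P (C ∩ (S n \ S (n + 1))) = 0 → P C = 0)
    {l : ℝ≥0∞} (hl0 : l ≠ 0) (hltop : l ≠ ∞) (M : ℕ → Ω → ℝ≥0∞) (L : Ω → ℝ≥0∞)
    (hM : ∀ n, Measurable[𝓖 n] (M n)) (hM0 : ∫⁻ ω, M 0 ω ∂P ≠ ∞)
    (hMA : ∀ n, ∀ ω ∈ A n, M (n + 1) ω = M n ω * l)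
    (hMB : ∀ n, ∀ ω ∈ B n, M (n + 1) ω = M n ω * l⁻¹)
    (hMR : ∀ n, ∀ ω ∉ S (n + 1), M (n + 1) ω = M n ω)
    (hL : ∀ n, ∀ ω ∉ S n, L ω = M n ω) :
    ∃ Q : Measure Ω, IsProbabilityMeasure Q ∧ Q ≪ P ∧ P ≪ Q ∧
      ∀ n, ∫⁻ ω, M n ω ∂Q ≠ ∞ ∧
        ∀ C, MeasurableSet[𝓖 n] C → ∫⁻ ω in C, L ω ∂Q = ∫⁻ ω in C, M n ω ∂Q := by
  have hSanti : Antitone S := antitone_nat_of_succ_le hSS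
  have hAm : ∀ n, MeasurableSet (A n) := fun n => 𝓖.le _ _ (hA n)
  have hBm : ∀ n, MeasurableSet (B n) := fun n => 𝓖.le _ _ (hB n)
  have hSm : ∀ n, MeasurableSet (S n) := fun n => 𝓖.le _ _ (hS n)
  have hABS' : ∀ n, A n ∪ B n ⊆ S n := fun n => (hABS n).trans_subset (hSS n)
  choose f₁ h₁m h₁0 h₁t h₁ using fun n => exists_inverse_condProb (𝓖.le n) P (hS n) (hAm n)
    (Set.subset_union_left.trans (hABS' n)) (hposA n)
  choose f₂ h₂m h₂0 h₂t h₂ using fun n => exists_inverse_condProb (𝓖.le n) P (hS n) (hBm n)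
    (Set.subset_union_right.trans (hABS' n)) (hposB n)
  choose f₀ h₀m h₀0 h₀t h₀ using fun n => exists_inverse_condProb (𝓖.le n) P (hS n)
    ((hSm n).diff (hSm (n + 1))) Set.sdiff_subset (hposR n)
  set q : ℝ≥0∞ := 2⁻¹ * (1 + l)⁻¹ with hq
  have h1l0 : 1 + l ≠ 0 := by simp
  have h1lt : 1 + l ≠ ∞ := by simp [hltop]
  have hq0 : q ≠ 0 := by simp [hq, hltop]
  have hqt : q ≠ ∞ := by simp [hq, ENNReal.mul_eq_top]
  have hsum : q + q * l = 2⁻¹ := by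
    rw [hq, ← mul_one_add, mul_assoc, ENNReal.inv_mul_cancel h1l0 h1lt, mul_one]
  have hswap : q * l + q * l * l⁻¹ = 2⁻¹ := by
    rw [mul_assoc q l, ENNReal.mul_inv_cancel hl0 hltop, mul_one, add_comm, hsum]
  set Z : ℕ → Ω → ℝ≥0∞ := fun n => stepWeight (S n) (A n) (B n) (fun ω => 2⁻¹ * f₀ n ω)
    (fun ω => q * f₁ n ω) (fun ω => q * l * f₂ n ω) with hZ
  set Z' : ℕ → Ω → ℝ≥0∞ := fun n => stepWeight (S n) (A n) (B n) (fun ω => 2⁻¹ * f₀ n ω)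
    (fun ω => q * l * f₁ n ω) (fun ω => q * l * l⁻¹ * f₂ n ω) with hZ'
  have hup : ∀ n {g : Ω → ℝ≥0∞}, Measurable[𝓖 n] g → Measurable[𝓖 (n + 1)] g := fun n g hg =>
    hg.mono (𝓖.mono n.le_succ) le_rfl
  have hZm : ∀ n, Measurable[𝓖 (n + 1)] (Z n) := fun n =>
    measurable_stepWeight (𝓖.mono n.le_succ _ (hS n)) (hA n) (hB n)
      ((hup n (h₀m n)).const_mul _) ((hup n (h₁m n)).const_mul _) ((hup n (h₂m n)).const_mul _)
  have hZ0 : ∀ n ω, Z n ω ≠ 0 := by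
    intro n ω
    simp only [hZ, stepWeight]
    split_ifs <;> simp [hq0, hl0, h₁0, h₂0, h₀0]
  have hZt : ∀ n ω, Z n ω ≠ ∞ := by
    intro n ω
    simp only [hZ, stepWeight]
    split_ifs <;> simp [ENNReal.mul_eq_top, hqt, hltop, h₁t, h₂t, h₀t]
  have hZ1 : ∀ n, ∀ ω ∉ S n, Z n ω = 1 := by
    intro n ω hω
    have h1 : ω ∉ A n := fun h => hω (hABS' n (Or.inl h))
    have h2 : ω ∉ B n := fun h => hω (hABS' n (Or.inr h))
    simp [hZ, stepWeight, h1, h2, hω]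
  set D : ℕ → Ω → ℝ≥0∞ := fun n ω => ∏ k ∈ Finset.range n, Z k ω with hD
  have hDsucc : ∀ n ω, D (n + 1) ω = D n ω * Z n ω := fun n ω => Finset.prod_range_succ _ _
  have hDm : ∀ n, Measurable[𝓖 n] (D n) := fun n =>
    Finset.measurable_fun_prod _ fun k hk =>
      (hZm k).mono (𝓖.mono (Finset.mem_range.1 hk)) le_rfl
  set Dl : Ω → ℝ≥0∞ := fun ω => liminf (fun n => D n ω) atTop with hDl
  have hDlm : Measurable Dl := Measurable.liminf fun n => (hDm n).mono (𝓖.le n) le_rfl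
  have hDlim : ∀ n, ∀ ω ∉ S n, Dl ω = D n ω := by
    intro n ω hω
    have : ∀ k, n ≤ k → D k ω = D n ω := by
      intro k hk
      induction k, hk using Nat.le_induction with
      | base => rfl
      | succ k hk ih => rw [hDsucc, hZ1 k ω (fun h => hω (hSanti hk h)), mul_one, ih]
    have ht : Tendsto (fun k => D k ω) atTop (𝓝 (D n ω)) :=
      tendsto_const_nhds.congr' ((eventually_ge_atTop n).mono fun k hk => (this k hk).symm)
    exact ht.liminf_eq
  have hex : ∀ ω, ∃ n, ω ∉ S n := by
    intro ω
    by_contra! h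
    have : ω ∈ ⋂ n, S n := Set.mem_iInter.2 h
    simp [hSempty] at this
  have hDl0 : ∀ ω, Dl ω ≠ 0 := by
    intro ω
    obtain ⟨n, hn⟩ := hex ω
    rw [hDlim n ω hn]
    exact Finset.prod_ne_zero_iff.2 fun k _ => hZ0 k ω
  have hstep : ∀ n (W : Ω → ℝ≥0∞), Measurable[𝓖 n] W →
      ∀ {c₁ c₂ : ℝ≥0∞}, c₁ + c₂ = 2⁻¹ → _ := fun n W hW c₁ c₂ hc =>
    stepWeight_lintegral P (hSm n) (hAm n) (hBm n) (hAB n) (hABS' n)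
      (hW.mono (𝓖.le n) le_rfl) ((h₀m n).mono (𝓖.le n) le_rfl) ((h₁m n).mono (𝓖.le n) le_rfl)
      ((h₂m n).mono (𝓖.le n) le_rfl) (by rw [hABS]; exact h₀ n W hW) (h₁ n W hW) (h₂ n W hW) hc
  have hDclosed := lintegral_mul_limit_eq P 𝓖 S hS hSanti hSempty D Z Dl hDm hDsucc hDlim
    (fun n W hW => (hstep n W hW hsum).2)
    (fun n W hW => by rw [← hABS]; exact (hstep n W hW hsum).1)
  have hMDsucc : ∀ n ω, M (n + 1) ω * D (n + 1) ω = M n ω * D n ω * Z' n ω := by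
    intro n ω
    rw [hDsucc]
    by_cases hωA : ω ∈ A n
    · rw [hMA n ω hωA]
      simp only [hZ, hZ', stepWeight, hωA, if_true]
      ring
    by_cases hωB : ω ∈ B n
    · rw [hMB n ω hωB]
      simp only [hZ, hZ', stepWeight, hωA, hωB, if_true, if_false]
      ring
    · rw [hMR n ω (by rw [← hABS]; simp [hωA, hωB])]
      simp only [hZ, hZ', stepWeight, hωA, hωB, if_false]
      ring
  have hMDclosed := lintegral_mul_limit_eq P 𝓖 S hS hSanti hSempty (fun n ω => M n ω * D n ω) Z'
    (fun ω => L ω * Dl ω) (fun n => (hM n).mul (hDm n)) hMDsucc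
    (fun n ω hω => by simp only [hL n ω hω, hDlim n ω hω])
    (fun n W hW => (hstep n W hW hswap).2)
    (fun n W hW => by rw [← hABS]; exact (hstep n W hW hswap).1)
  have hMDfin : ∀ n, ∫⁻ ω, M n ω * D n ω ∂P ≠ ∞ := by
    intro n
    induction n with
    | zero => simpa [hD] using hM0
    | succ n ih =>
      simp_rw [hMDsucc]
      rwa [(hstep n (fun ω => M n ω * D n ω) ((hM n).mul (hDm n)) hswap).2]
  have hone : ∫⁻ ω, Dl ω ∂P = 1 := by
    have := hDclosed 0 (fun _ => 1) measurable_const (by simp [hD])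
    simpa [hD] using this
  have hQ : ∀ (C : Set Ω), MeasurableSet C → ∀ g : Ω → ℝ≥0∞,
      ∫⁻ ω in C, g ω ∂(P.withDensity Dl) = ∫⁻ ω in C, g ω * Dl ω ∂P := by
    intro C hC g
    have hfin : ∀ᵐ ω ∂P.restrict C, Dl ω < ∞ := by
      refine ae_of_all _ fun ω => ?_
      obtain ⟨n, hn⟩ := hex ω
      rw [hDlim n ω hn]
      exact ENNReal.prod_lt_top fun k _ => (hZt k ω).lt_top
    rw [setLIntegral_withDensity_eq_setLIntegral_mul_non_measurable P hDlm _ hC hfin]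
    simp only [Pi.mul_apply, mul_comm]
  refine ⟨P.withDensity Dl, ⟨?_⟩, withDensity_absolutelyContinuous _ _,
    withDensity_absolutelyContinuous' hDlm.aemeasurable (ae_of_all _ hDl0), fun n => ?_⟩
  · rw [withDensity_apply _ MeasurableSet.univ, Measure.restrict_univ, hone]
  · have hMn : ∀ C, MeasurableSet[𝓖 n] C →
        ∫⁻ ω in C, M n ω ∂(P.withDensity Dl) = ∫⁻ ω in C, M n ω * D n ω ∂P := by
      intro C hC
      have hCm : MeasurableSet C := 𝓖.le n _ hC
      rw [hQ C hCm, ← lintegral_indicator hCm, ← lintegral_indicator hCm]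
      have := hDclosed n (C.indicator (M n)) ((hM n).indicator hC)
        (ne_top_of_le_ne_top (hMDfin n) (lintegral_mono fun ω => by
          by_cases h : ω ∈ C <;> simp [h]))
      convert this using 2 with ω
      all_goals
        ext ω
        by_cases h : ω ∈ C <;> simp [h]
    refine ⟨?_, fun C hC => ?_⟩
    · have := hMn Set.univ MeasurableSet.univ
      rw [Measure.restrict_univ, Measure.restrict_univ] at this
      rw [this]
      exact hMDfin n
    · have hCm : MeasurableSet C := 𝓖.le n _ hC
      rw [hMn C hC, hQ C hCm]
      have := hMDclosed n (C.indicator fun _ => 1) (measurable_const.indicator hC)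
        (ne_top_of_le_ne_top (hMDfin n) (lintegral_mono fun ω => by
          by_cases h : ω ∈ C <;> simp [h]))
      rw [← lintegral_indicator hCm, ← lintegral_indicator hCm]
      convert this using 2 with ω
      all_goals
        ext ω
        by_cases h : ω ∈ C <;> simp [h]

end Discrete

section HittingTimes

open Filter Topology

section Definitions

variable {ι Ω : Type*} [LinearOrder ι] [BoundedOrder ι]

open Classical in
/-- The first time at which the path `w` reaches level `a`, or the final time. -/
noncomputable def firstHit (a : ℝ) (w : ι → ℝ) : ι :=
  if h : ∃ s, IsLeast {t | a ≤ w t ∨ t = ⊤} s then h.choose else ⊤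

/-- The successive times at which the process `X` has moved by `a`, capped by the final time. -/
noncomputable def walkTime (a : ℝ) (X : ι → Ω → ℝ) : ℕ → Ω → ι
  | 0, _ => ⊥
  | n + 1, ω => firstHit a fun s => |X s ω - X (min s (walkTime a X n ω)) ω|

end Definitions

variable {ι Ω : Type*} [LinearOrder ι] [TopologicalSpace ι] [OrderTopology ι]

theorem continuous_abs_sub_stopped {X : ι → Ω → ℝ} (hX : ∀ ω, Continuous fun t => X t ω)
    (t : ι) (ω : Ω) :
    Continuous fun s => |X s ω - X (min s t) ω| :=
  ((hX ω).sub ((hX ω).comp (continuous_id.min continuous_const))).abs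

variable [CompactSpace ι] [BoundedOrder ι]

theorem isLeast_firstHit {a : ℝ} {w : ι → ℝ} (hw : Continuous w) :
    IsLeast {t | a ≤ w t ∨ t = ⊤} (firstHit a w) := by
  have hc : IsClosed {t | a ≤ w t ∨ t = ⊤} :=
    (isClosed_le continuous_const hw).union isClosed_singleton
  have h : ∃ s, IsLeast {t | a ≤ w t ∨ t = ⊤} s :=
    hc.isCompact.exists_isLeast ⟨⊤, Or.inr rfl⟩
  rw [firstHit, dif_pos h]
  exact h.choose_spec

theorem lt_of_lt_firstHit {a : ℝ} {w : ι → ℝ} (hw : Continuous w) {t : ι}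
    (ht : t < firstHit a w) : w t < a := by
  by_contra! h
  exact absurd ((isLeast_firstHit hw).2 (Or.inl h)) (not_le.2 ht)

theorem le_firstHit_value {a : ℝ} {w : ι → ℝ} (hw : Continuous w)
    (h : firstHit a w ≠ ⊤) : a ≤ w (firstHit a w) :=
  (isLeast_firstHit hw).1.resolve_right h

theorem le_of_le_firstHit [DenselyOrdered ι] {a : ℝ} {w : ι → ℝ} (hw : Continuous w)
    (h0 : w ⊥ ≤ a) {t : ι} (ht : t ≤ firstHit a w) : w t ≤ a := by
  rcases ht.lt_or_eq with h | rfl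
  · exact (lt_of_lt_firstHit hw h).le
  · by_contra! h
    have hne : (⊥ : ι) < firstHit a w := bot_lt_iff_ne_bot.2 fun e => by
      rw [e] at h
      exact absurd h0 (not_le.2 h)
    obtain ⟨l, hl, hsub⟩ := exists_Ioc_subset_of_mem_nhds
      ((isOpen_lt continuous_const hw).mem_nhds h) ⟨⊥, hne⟩
    obtain ⟨y, hy1, hy2⟩ := exists_between hl
    exact absurd (lt_of_lt_firstHit hw hy2) (not_lt.2 (le_of_lt (hsub ⟨hy1, hy2.le⟩)))

variable {m : MeasurableSpace Ω}

theorem isStoppingTime_firstHit [SecondCountableTopology ι] (𝓕 : Filtration ι m) (a : ℝ)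
    (W : ι → Ω → ℝ) (hW : ∀ ω, Continuous fun t => W t ω) (hWad : ∀ t, Measurable[𝓕 t] (W t)) :
    IsStoppingTime 𝓕 fun ω => ((firstHit a fun t => W t ω : ι) : WithTop ι) := by
  intro t
  simp only [WithTop.coe_le_coe]
  by_cases ht : t = ⊤
  · simp [ht]
  obtain ⟨D, hDc, hDd⟩ := TopologicalSpace.exists_countable_dense (Set.Iic t)
  have : {ω | firstHit a (fun t => W t ω) ≤ t}
      = ⋂ k : ℕ, ⋃ q ∈ D, {ω | a - 1 / ((k : ℝ) + 1) < W (q : ι) ω} := by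
    ext ω
    simp only [Set.mem_ofPred_eq, Set.mem_iInter, Set.mem_iUnion, exists_prop]
    have hc : Continuous fun q : Set.Iic t => W (q : ι) ω := (hW ω).comp continuous_subtype_val
    constructor
    · intro h k
      have h1 := le_firstHit_value (a := a) (hW ω) (fun e => ht (top_le_iff.1 (e ▸ h)))
      have hk : (0 : ℝ) < 1 / ((k : ℝ) + 1) := by positivity
      obtain ⟨q, hqD, hq⟩ := hDd.exists_mem_open
        (isOpen_lt (continuous_const (y := a - 1 / ((k : ℝ) + 1))) hc)
        ⟨⟨firstHit a fun t => W t ω, h⟩, by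
          show a - 1 / ((k : ℝ) + 1) < W (firstHit a fun t => W t ω) ω
          linarith⟩
      exact ⟨q, hqD, hq⟩
    · intro h
      have hcomp : IsCompact (Set.Iic t) := isClosed_Iic.isCompact
      obtain ⟨s, hs, hmax⟩ := hcomp.exists_isMaxOn ⟨t, le_rfl⟩ (hW ω).continuousOn
      have has : a ≤ W s ω := by
        have hlim : Tendsto (fun k : ℕ => a - 1 / ((k : ℝ) + 1)) atTop (𝓝 (a - 0)) :=
          tendsto_const_nhds.sub tendsto_one_div_add_atTop_nhds_zero_nat
        rw [sub_zero] at hlim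
        refine le_of_tendsto' hlim fun k => ?_
        obtain ⟨q, -, hq⟩ := h k
        exact hq.le.trans (hmax q.2)
      exact ((isLeast_firstHit (hW ω)).2 (Or.inl has)).trans hs
  rw [this]
  refine MeasurableSet.iInter fun k => MeasurableSet.biUnion hDc fun q _ => ?_
  exact measurableSet_lt measurable_const ((hWad q).mono (𝓕.mono q.2) le_rfl)

section

variable {a : ℝ} {X : ι → Ω → ℝ} (hX : ∀ ω, Continuous fun t => X t ω)
include hX

theorem walkTime_le_succ (ha : 0 < a) (n : ℕ) (ω : Ω) :
    walkTime a X n ω ≤ walkTime a X (n + 1) ω := by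
  by_contra! h
  have h1 := le_firstHit_value (a := a) (continuous_abs_sub_stopped hX (walkTime a X n ω) ω)
    (ne_top_of_lt h)
  change a ≤ |X (walkTime a X (n + 1) ω) ω
    - X (min (walkTime a X (n + 1) ω) (walkTime a X n ω)) ω| at h1
  rw [min_eq_left h.le, sub_self, abs_zero] at h1
  linarith

theorem abs_sub_walkTime_lt {n : ℕ} {ω : Ω} {t : ι} (h1 : walkTime a X n ω ≤ t)
    (h2 : t < walkTime a X (n + 1) ω) : |X t ω - X (walkTime a X n ω) ω| < a := by
  have := lt_of_lt_firstHit (continuous_abs_sub_stopped hX (walkTime a X n ω) ω) h2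
  rwa [min_eq_right h1] at this

theorem abs_sub_walkTime_le [DenselyOrdered ι] (ha : 0 < a) {n : ℕ} {ω : Ω} {t : ι}
    (h1 : walkTime a X n ω ≤ t) (h2 : t ≤ walkTime a X (n + 1) ω) :
    |X t ω - X (walkTime a X n ω) ω| ≤ a := by
  have := le_of_le_firstHit (continuous_abs_sub_stopped hX (walkTime a X n ω) ω)
    (by simpa using ha.le) h2
  rwa [min_eq_right h1] at this

theorem abs_sub_walkTime_succ [DenselyOrdered ι] (ha : 0 < a) {n : ℕ} {ω : Ω}
    (h : walkTime a X (n + 1) ω ≠ ⊤) :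
    |X (walkTime a X (n + 1) ω) ω - X (walkTime a X n ω) ω| = a := by
  have hle := walkTime_le_succ hX ha n ω
  refine le_antisymm (abs_sub_walkTime_le hX ha hle le_rfl) ?_
  have := le_firstHit_value (continuous_abs_sub_stopped hX (walkTime a X n ω) ω) h
  change a ≤ |X (walkTime a X (n + 1) ω) ω
    - X (min (walkTime a X (n + 1) ω) (walkTime a X n ω)) ω| at this
  rwa [min_eq_right hle] at this

theorem walkTime_succ_le {n : ℕ} {ω : Ω} {t : ι} (h1 : walkTime a X n ω ≤ t)
    (h2 : a ≤ |X t ω - X (walkTime a X n ω) ω|) : walkTime a X (n + 1) ω ≤ t := by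
  by_contra! h
  exact absurd (abs_sub_walkTime_lt hX h1 h) (not_lt.2 h2)

theorem exists_walkTime_eq_top [DenselyOrdered ι] [SecondCountableTopology ι] (ha : 0 < a)
    (ω : Ω) : ∃ n, walkTime a X n ω = ⊤ := by
  by_contra! h
  have hmono : Monotone fun n => walkTime a X n ω :=
    monotone_nat_of_le_succ fun n => walkTime_le_succ hX ha n ω
  obtain ⟨s, hs⟩ : ∃ s, Tendsto (fun n => walkTime a X n ω) atTop (𝓝 s) := by
    obtain ⟨s, -, φ, hφ, hs⟩ := isCompact_univ.tendsto_subseq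
      (x := fun n => walkTime a X n ω) fun _ => Set.mem_univ _
    refine ⟨s, tendsto_atTop_isLUB hmono ⟨?_, ?_⟩⟩
    · rintro _ ⟨n, rfl⟩
      refine ge_of_tendsto hs ((eventually_ge_atTop n).mono fun k hk => ?_)
      exact hmono (hk.trans (hφ.id_le k))
    · exact fun b hb => le_of_tendsto' hs fun k => hb ⟨φ k, rfl⟩
  have h1 : Tendsto (fun n => X (walkTime a X n ω) ω) atTop (𝓝 (X s ω)) :=
    ((hX ω).tendsto s).comp hs
  have h2 := (((tendsto_add_atTop_iff_nat 1).2 h1).sub h1).abs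
  simp_rw [abs_sub_walkTime_succ hX ha (h _)] at h2
  have := tendsto_nhds_unique h2 tendsto_const_nhds
  simp at this
  linarith

theorem isStoppingTime_walkTime [SecondCountableTopology ι] [TopologicalSpace.MetrizableSpace ι]
    [MeasurableSpace ι] [BorelSpace ι] (𝓕 : Filtration ι m) (had : StronglyAdapted 𝓕 X) (n : ℕ) :
    IsStoppingTime 𝓕 fun ω => ((walkTime a X n ω : ι) : WithTop ι) := by
  induction n with
  | zero => exact isStoppingTime_const 𝓕 ⊥
  | succ n ih =>
    refine isStoppingTime_firstHit 𝓕 a (fun s ω => |X s ω - X (min s (walkTime a X n ω)) ω|)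
      (fun ω => continuous_abs_sub_stopped hX _ ω) fun t => ?_
    have h1 := had.stoppedProcess (fun ω => hX ω) ih t
    have h2 : StronglyMeasurable[𝓕 t] fun ω => X (min t (walkTime a X n ω)) ω := by
      convert h1 using 2 with ω
      rw [stoppedProcess, ← WithTop.coe_min]
      rfl
    exact ((had t).sub h2).norm.measurable

end

end HittingTimes

section Assembly

open Filter Topology

section CondExp

variable {Ω : Type*} {G m : MeasurableSpace Ω}

theorem measure_eq_zero_of_condProb_pos (hG : G ≤ m) (P : Measure Ω) [IsProbabilityMeasure P]
    {F A : Set Ω} (h : ∀ᵐ ω ∂P, 0 < (P[F.indicator (fun _ => (1 : ℝ)) | G]) ω)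
    (hA : MeasurableSet[G] A) (h0 : P (A ∩ F) = 0) : P A = 0 := by
  by_cases hint : Integrable (F.indicator fun _ => (1 : ℝ)) P
  · have h1 := setIntegral_condExp hG hint hA
    have h2 : ∫ ω in A, F.indicator (fun _ => (1 : ℝ)) ω ∂P = 0 := by
      refine integral_eq_zero_of_ae ?_
      rw [EventuallyEq, ae_restrict_iff' (hG _ hA)]
      filter_upwards [measure_eq_zero_iff_ae_notMem.1 h0] with ω hω hωA
      exact Set.indicator_of_notMem (fun hF => hω ⟨hωA, hF⟩) _
    rw [h2, setIntegral_eq_zero_iff_of_nonneg_ae (ae_restrict_of_ae (h.mono fun ω hω => hω.le))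
      integrable_condExp.integrableOn, EventuallyEq, ae_restrict_iff' (hG _ hA)] at h1
    rw [measure_eq_zero_iff_ae_notMem]
    filter_upwards [h, h1] with ω ha hb hωA
    exact ha.ne' (hb hωA)
  · rw [condExp_of_not_integrable hint] at h
    rw [measure_eq_zero_iff_ae_notMem]
    filter_upwards [h] with ω hω
    exact absurd hω (lt_irrefl _)

theorem lintegral_ne_top_of_trivial (hG : G ≤ m) (P : Measure Ω) [IsProbabilityMeasure P]
    (htriv : ∀ A : Set Ω, MeasurableSet[G] A → P A = 0 ∨ P A = 1) {f : Ω → ℝ≥0∞}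
    (hf : Measurable[G] f) (hfin : ∀ ω, f ω ≠ ∞) : ∫⁻ ω, f ω ∂P ≠ ∞ := by
  obtain ⟨x, hx⟩ := exists_eventuallyEq_const_of_forall_separating (l := ae P) (f := f)
    MeasurableSet (fun U hU => by
      rcases htriv _ (hf hU) with h | h
      · exact Or.inr (measure_eq_zero_iff_ae_notMem.1 h)
      · exact Or.inl ((prob_compl_eq_zero_iff (hG _ (hf hU))).2 h))
  obtain ⟨ω, hω⟩ := hx.exists
  rw [lintegral_congr_ae hx]
  have := hfin ω
  rw [hω] at this
  simpa using this

end CondExp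

/-- If, on all events known at time `t`, the expectation of a terminal price `L` is comparable to
that of `Y t`, then truncating the martingale closed by `L` gives a consistent price system. -/
theorem admitsCPS_of_setLIntegral_le {Ω ι : Type*} [Preorder ι] {m : MeasurableSpace Ω}
    {𝓕 : Filtration ι m} {P Q : Measure Ω} [IsProbabilityMeasure Q] (hQP : Q ≪ P) (hPQ : P ≪ Q)
    {ε : ℝ} (hε : 0 < ε) {Y : ι → Ω → ℝ} (hY : ∀ t, Measurable[𝓕 t] (Y t))
    (hYpos : ∀ t ω, 0 < Y t ω) {L : Ω → ℝ≥0∞} (hL : Measurable L) (hLfin : ∫⁻ ω, L ω ∂Q ≠ ∞)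
    (hle : ∀ t A, MeasurableSet[𝓕 t] A →
      ∫⁻ ω in A, L ω ∂Q ≤ ENNReal.ofReal (1 + ε) * ∫⁻ ω in A, ENNReal.ofReal (Y t ω) ∂Q)
    (hge : ∀ t A, MeasurableSet[𝓕 t] A →
      ∫⁻ ω in A, ENNReal.ofReal (Y t ω) ∂Q ≤ ENNReal.ofReal (1 + ε) * ∫⁻ ω in A, L ω ∂Q) :
    AdmitsCPS 𝓕 P ε Y := by
  set c : ℝ := 1 + ε with hc
  have hc1 : 1 ≤ c := by linarith
  have hc0 : 0 < c := by linarith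
  set N : Ω → ℝ := fun ω => (L ω).toReal with hN
  have hNint : Integrable N Q := integrable_toReal_of_lintegral_ne_top hL.aemeasurable hLfin
  have hYm : ∀ t, Measurable (Y t) := fun t => (hY t).mono (𝓕.le t) le_rfl
  have hLA : ∀ A, ∫⁻ ω in A, L ω ∂Q ≠ ∞ := fun A =>
    ne_top_of_le_ne_top hLfin (setLIntegral_le_lintegral _ _)
  have hYA : ∀ t A, MeasurableSet[𝓕 t] A → ∫⁻ ω in A, ENNReal.ofReal (Y t ω) ∂Q ≠ ∞ :=
    fun t A hA => ne_top_of_le_ne_top (ENNReal.mul_ne_top ENNReal.ofReal_ne_top (hLA A))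
      (hge t A hA)
  have hYint : ∀ t, Integrable (Y t) Q := by
    intro t
    refine ⟨(hYm t).aestronglyMeasurable, ?_⟩
    have := hYA t Set.univ MeasurableSet.univ
    rw [Measure.restrict_univ] at this
    rw [hasFiniteIntegral_iff_ofReal (ae_of_all _ fun ω => (hYpos t ω).le)]
    exact this.lt_top
  have hYI : ∀ t A, ∫ ω in A, Y t ω ∂Q = (∫⁻ ω in A, ENNReal.ofReal (Y t ω) ∂Q).toReal :=
    fun t A => integral_eq_lintegral_of_nonneg_ae (ae_of_all _ fun ω => (hYpos t ω).le)
      (hYm t).aestronglyMeasurable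
  have hNI : ∀ A, ∫ ω in A, N ω ∂Q = (∫⁻ ω in A, L ω ∂Q).toReal := fun A =>
    integral_toReal hL.aemeasurable
      (ae_restrict_of_ae (ae_lt_top hL hLfin))
  have hYs : ∀ t, StronglyMeasurable[𝓕 t] (Y t) := fun t => (hY t).stronglyMeasurable
  have hZs : ∀ t, StronglyMeasurable[𝓕 t] (Q[N | 𝓕 t]) := fun t => stronglyMeasurable_condExp
  have hup : ∀ t, Q[N | 𝓕 t] ≤ᵐ[Q] fun ω => c * Y t ω := by
    intro t
    refine ae_le_of_ae_le_trim (hm := 𝓕.le t) (ae_le_of_forall_setIntegral_le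
      (integrable_condExp.trim _ (hZs t)) (((hYint t).const_mul c).trim _ ((hYs t).const_mul c))
      fun A hA _ => ?_)
    rw [← setIntegral_trim (𝓕.le t) (hZs t) hA,
      ← setIntegral_trim (𝓕.le t) ((hYs t).const_mul c) hA, setIntegral_condExp (𝓕.le t) hNint hA,
      integral_const_mul, hNI, hYI]
    have := ENNReal.toReal_mono (ENNReal.mul_ne_top ENNReal.ofReal_ne_top (hYA t A hA)) (hle t A hA)
    rwa [ENNReal.toReal_mul, ENNReal.toReal_ofReal hc0.le] at this
  have hlow : ∀ t, (fun ω => c⁻¹ * Y t ω) ≤ᵐ[Q] Q[N | 𝓕 t] := by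
    intro t
    refine ae_le_of_ae_le_trim (hm := 𝓕.le t) (ae_le_of_forall_setIntegral_le
      (((hYint t).const_mul c⁻¹).trim _ ((hYs t).const_mul c⁻¹)) (integrable_condExp.trim _ (hZs t))
      fun A hA _ => ?_)
    rw [← setIntegral_trim (𝓕.le t) (hZs t) hA,
      ← setIntegral_trim (𝓕.le t) ((hYs t).const_mul c⁻¹) hA,
      setIntegral_condExp (𝓕.le t) hNint hA, integral_const_mul, hNI, hYI]
    have := ENNReal.toReal_mono (ENNReal.mul_ne_top ENNReal.ofReal_ne_top (hLA A)) (hge t A hA)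
    rw [ENNReal.toReal_mul, ENNReal.toReal_ofReal hc0.le] at this
    rwa [inv_mul_le_iff₀ hc0]
  set M : ι → Ω → ℝ := fun t ω => max (c⁻¹ * Y t ω) (min (c * Y t ω) ((Q[N | 𝓕 t]) ω)) with hM
  have hMZ : ∀ t, M t =ᵐ[Q] Q[N | 𝓕 t] := by
    intro t
    filter_upwards [hup t, hlow t] with ω h1 h2
    simp only [hM]
    rw [min_eq_right h1, max_eq_right h2]
  have hmart := martingale_condExp N 𝓕 Q
  refine ⟨Q, M, inferInstance, hQP, hPQ, ⟨fun t => ?_, fun s t hst => ?_⟩, ae_of_all _ fun ω t => ?_⟩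
  · exact (((hY t).const_mul _).max
      (((hY t).const_mul _).min (hZs t).measurable)).stronglyMeasurable
  · exact (condExp_congr_ae (hMZ t)).trans ((hmart.2 s t hst).trans (hMZ s).symm)
  · refine ⟨le_max_left _ _, max_le ?_ (min_le_left _ _)⟩
    have : c⁻¹ ≤ c := (inv_le_one_of_one_le₀ hc1).trans hc1
    exact mul_le_mul_of_nonneg_right this (hYpos t ω).le

theorem measurableSet_inter_lt_stoppingTime {Ω ι : Type*} [LinearOrder ι] {m : MeasurableSpace Ω}
    {𝓕 : Filtration ι m} {τ : Ω → WithTop ι} (hτ : IsStoppingTime 𝓕 τ) {t : ι} {A : Set Ω}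
    (hA : MeasurableSet[𝓕 t] A) : MeasurableSet[hτ.measurableSpace] (A ∩ {ω | t < τ ω}) := by
  have h1 : MeasurableSet[𝓕 t] (A ∩ {ω | t < τ ω}) := MeasurableSet.inter hA (hτ.measurableSet_gt t)
  rw [hτ.measurableSet]
  refine ⟨le_iSup (fun i => 𝓕 i) t _ h1, fun i => ?_⟩
  rcases le_total i t with h | h
  · convert MeasurableSet.empty using 1
    ext ω
    simp only [Set.mem_inter_iff, Set.mem_ofPred_eq, Set.mem_empty_iff_false, iff_false]
    rintro ⟨⟨-, h2⟩, h3⟩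
    exact absurd (h2.trans_le (h3.trans (WithTop.coe_le_coe.2 h))) (lt_irrefl _)
  · exact (𝓕.mono h _ h1).inter (hτ i)

section Event

variable {Ω : Type*} {T : ℝ} (hT : 0 ≤ T) {X : Set.Icc (0 : ℝ) T → Ω → ℝ}
  {τ : Ω → Set.Icc (0 : ℝ) T} {ω : Ω} {h δ c : ℝ}

theorem increment_sub (u : Set.Icc (0 : ℝ) T) :
    increment hT X τ ω ((u : ℝ) - τ ω) = X u ω - X (τ ω) ω := by
  rw [increment, add_sub_cancel, Set.IccExtend_val]

variable (hX : Continuous fun t => X t ω)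
include hX

theorem continuous_increment : Continuous (increment hT X τ ω) := by
  have : Continuous (Set.IccExtend hT fun s => X s ω) := hX.Icc_extend'
  exact (this.comp (continuous_const.add continuous_id)).sub continuous_const

theorem abs_sub_lt_of_mem_event_zero (hω : ω ∈ event hT X τ h δ c 0) {u : Set.Icc (0 : ℝ) T}
    (h1 : τ ω ≤ u) (h2 : (u : ℝ) < T) : |X u ω - X (τ ω) ω| < δ := by
  have hb : BddAbove ((fun t => |increment hT X τ ω t|) '' Set.Ico 0 (T - τ ω)) :=
    ((isCompact_Icc (a := (0 : ℝ)) (b := T - τ ω)).bddAbove_image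
      (continuous_increment hT hX).abs.continuousOn).mono (Set.image_mono Set.Ico_subset_Icc_self)
  have h1' : (τ ω : ℝ) ≤ u := h1
  refine lt_of_le_of_lt (le_csSup hb ⟨(u : ℝ) - τ ω, ⟨by linarith, by linarith⟩, ?_⟩) hω
  simp only [increment_sub]

theorem sub_lt_of_mem_event_pos (hω : ω ∈ event hT X τ h δ c 1) {u : Set.Icc (0 : ℝ) T}
    (h1 : τ ω ≤ u) : ((u : ℝ) ≤ τ ω + h → X u ω - X (τ ω) ω < δ) ∧
      ((τ ω : ℝ) + h ≤ u → (u : ℝ) < T → X u ω - X (τ ω) ω < -c) := by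
  have h1' : (τ ω : ℝ) ≤ u := h1
  constructor
  · intro h2
    have hb : BddAbove (increment hT X τ ω '' Set.Icc 0 h) :=
      isCompact_Icc.bddAbove_image (continuous_increment hT hX).continuousOn
    exact lt_of_le_of_lt (le_csSup hb
      ⟨(u : ℝ) - τ ω, ⟨by linarith, by linarith⟩, increment_sub hT u⟩) hω.1
  · intro h2 h3
    have hb : BddAbove (increment hT X τ ω '' Set.Ico h (T - τ ω)) :=
      ((isCompact_Icc (a := h) (b := T - τ ω)).bddAbove_image
        (continuous_increment hT hX).continuousOn).mono (Set.image_mono Set.Ico_subset_Icc_self)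
    exact lt_of_le_of_lt (le_csSup hb
      ⟨(u : ℝ) - τ ω, ⟨by linarith, by linarith⟩, increment_sub hT u⟩) hω.2

theorem lt_sub_of_mem_event_neg (hω : ω ∈ event hT X τ h δ c (-1)) {u : Set.Icc (0 : ℝ) T}
    (h1 : τ ω ≤ u) : ((u : ℝ) ≤ τ ω + h → -δ < X u ω - X (τ ω) ω) ∧
      ((τ ω : ℝ) + h ≤ u → (u : ℝ) < T → c < X u ω - X (τ ω) ω) := by
  have h1' : (τ ω : ℝ) ≤ u := h1
  constructor
  · intro h2
    have hb : BddBelow (increment hT X τ ω '' Set.Icc 0 h) :=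
      isCompact_Icc.bddBelow_image (continuous_increment hT hX).continuousOn
    exact lt_of_lt_of_le hω.1 (csInf_le hb
      ⟨(u : ℝ) - τ ω, ⟨by linarith, by linarith⟩, increment_sub hT u⟩)
  · intro h2 h3
    have hb : BddBelow (increment hT X τ ω '' Set.Ico h (T - τ ω)) :=
      ((isCompact_Icc (a := h) (b := T - τ ω)).bddBelow_image
        (continuous_increment hT hX).continuousOn).mono (Set.image_mono Set.Ico_subset_Icc_self)
    exact lt_of_lt_of_le hω.2 (csInf_le hb
      ⟨(u : ℝ) - τ ω, ⟨by linarith, by linarith⟩, increment_sub hT u⟩)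

end Event

end Assembly

section Market

open Filter Topology

variable {Ω : Type*} {m : MeasurableSpace Ω}

/-- If the event `F^j` always has positive conditional probability, then every set on which `F^j`
forces a given behaviour `E` after the stopping time `τ` charges `E` conditionally on `{τ < T}`. -/
theorem measure_eq_zero_of_event_subset {P : Measure Ω} [IsProbabilityMeasure P]
    {T : ℝ} (hT : 0 < T) {𝓕 : Filtration (Set.Icc (0 : ℝ) T) m}
    {X : Set.Icc (0 : ℝ) T → Ω → ℝ} {a : ℝ} {j : SignType}
    (hF : ∀ h : ℝ, h ∈ Set.Ioo 0 T →
      ∀ (τ : Ω → Set.Icc (0 : ℝ) T)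
        (hτ : IsStoppingTime 𝓕 (fun ω => (τ ω : WithTop (Set.Icc (0 : ℝ) T)))),
      (∀ ω, (τ ω : ℝ) < T - h) → ∀ᵐ ω ∂P,
        0 < (P[(event hT.le X τ h a a j).indicator (fun _ => (1 : ℝ)) | hτ.measurableSpace]) ω)
    {τ : Ω → Set.Icc (0 : ℝ) T}
    (hτ : IsStoppingTime 𝓕 (fun ω => (τ ω : WithTop (Set.Icc (0 : ℝ) T)))) {E C : Set Ω}
    (hE : ∀ (h : ℝ) (σ : Ω → Set.Icc (0 : ℝ) T) (ω : Ω), 0 < h → σ ω = τ ω → (τ ω : ℝ) + h < T →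
      ω ∈ event hT.le X σ h a a j → ω ∈ E)
    (hC : MeasurableSet[hτ.measurableSpace] C) (hCT : ∀ ω ∈ C, (τ ω : ℝ) < T)
    (h0 : P (C ∩ E) = 0) : P C = 0 := by
  have hk : ∀ k : ℕ, (0 : ℝ) < T / ((k : ℝ) + 3) := fun k => by positivity
  have hk3 : ∀ k : ℕ, T / ((k : ℝ) + 3) * 3 ≤ T := fun k => by
    have : (0 : ℝ) ≤ k := k.cast_nonneg
    rw [div_mul_eq_mul_div, div_le_iff₀ (by positivity)]
    nlinarith
  let s : ℕ → Set.Icc (0 : ℝ) T := fun k =>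
    ⟨T - 2 * (T / ((k : ℝ) + 3)), by linarith [hk3 k, hk k], by linarith [hk k]⟩
  have hs : ∀ k, (s k : ℝ) = T - 2 * (T / ((k : ℝ) + 3)) := fun k => rfl
  have hcover : C ⊆ ⋃ k, C ∩ {ω | τ ω ≤ s k} := by
    intro ω hω
    have hlim : Tendsto (fun k : ℕ => T - 2 * (T / ((k : ℝ) + 3))) atTop (𝓝 (T - 2 * 0)) :=
      tendsto_const_nhds.sub (Tendsto.const_mul 2 (Tendsto.div_atTop tendsto_const_nhds
        (tendsto_atTop_add_const_right _ _ tendsto_natCast_atTop_atTop)))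
    rw [mul_zero, sub_zero] at hlim
    obtain ⟨k, hkω⟩ := (hlim.eventually (lt_mem_nhds (hCT ω hω))).exists
    exact Set.mem_iUnion.2 ⟨k, hω, hkω.le⟩
  refine measure_mono_null hcover (measure_iUnion_null fun k => ?_)
  have hσ : IsStoppingTime 𝓕
      (fun ω => ((min (τ ω) (s k) : Set.Icc (0 : ℝ) T) : WithTop (Set.Icc (0 : ℝ) T))) :=
    hτ.min_const (s k)
  have hCk : MeasurableSet[hσ.measurableSpace] (C ∩ {ω | τ ω ≤ s k}) := by
    have := hτ.measurableSet_inter_le (isStoppingTime_const 𝓕 (s k)) C hC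
    simpa only [WithTop.coe_le_coe] using this
  refine measure_eq_zero_of_condProb_pos hσ.measurableSpace_le P
    (hF (T / ((k : ℝ) + 3)) ⟨hk k, by linarith [hk k, hk3 k]⟩ (fun ω => min (τ ω) (s k)) hσ
      fun ω => ?_) hCk ?_
  · have h1 : ((min (τ ω) (s k) : Set.Icc (0 : ℝ) T) : ℝ) ≤ s k := min_le_right (τ ω) (s k)
    rw [hs] at h1
    linarith [hk k]
  · refine measure_mono_null ?_ h0
    rintro ω ⟨⟨hω, hle⟩, hev⟩
    refine ⟨hω, hE _ _ ω (hk k) (min_eq_left hle) ?_ hev⟩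
    have h1 : (τ ω : ℝ) ≤ s k := hle
    rw [hs] at h1
    linarith [hk k]

theorem lt_top_iff_coe_lt {T : ℝ} [Fact ((0 : ℝ) ≤ T)] (u : Set.Icc (0 : ℝ) T) :
    u < ⊤ ↔ (u : ℝ) < T :=
  Iff.rfl

section

variable {T : ℝ} [Fact ((0 : ℝ) ≤ T)] {X : Set.Icc (0 : ℝ) T → Ω → ℝ}
  (hX : ∀ ω, Continuous fun t => X t ω) {a : ℝ} {n : ℕ} {ω : Ω}
include hX

theorem walkTime_succ_eq_top_of_mem_event (hT : 0 ≤ T) (ha : 0 < a) {h : ℝ}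
    {σ : Ω → Set.Icc (0 : ℝ) T} (hσ : σ ω = walkTime a X n ω)
    (hω : ω ∈ event hT X σ h a a 0) : walkTime a X (n + 1) ω = ⊤ := by
  by_contra hne
  have h1 := abs_sub_walkTime_succ hX ha hne
  have h2 := abs_sub_lt_of_mem_event_zero hT (hX ω) hω (u := walkTime a X (n + 1) ω)
    (hσ ▸ walkTime_le_succ hX ha n ω) ((lt_top_iff_coe_lt _).1 (lt_top_iff_ne_top.2 hne))
  rw [hσ, h1] at h2
  exact lt_irrefl _ h2

theorem walkTime_succ_of_mem_event_pos (hT : 0 ≤ T) (ha : 0 < a) {h : ℝ} (hh : 0 < h)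
    {σ : Ω → Set.Icc (0 : ℝ) T} (hσ : σ ω = walkTime a X n ω)
    (hlt : ((walkTime a X n ω : Set.Icc (0 : ℝ) T) : ℝ) + h < T)
    (hω : ω ∈ event hT X σ h a a 1) :
    walkTime a X (n + 1) ω < ⊤ ∧
      X (walkTime a X (n + 1) ω) ω < X (walkTime a X n ω) ω := by
  set τ : Set.Icc (0 : ℝ) T := walkTime a X n ω with hτ
  have hev : ∀ {u : Set.Icc (0 : ℝ) T}, τ ≤ u → _ := fun {u} hu =>
    sub_lt_of_mem_event_pos hT (hX ω) hω (u := u) (hσ ▸ hu)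
  simp only [hσ] at hev
  let u : Set.Icc (0 : ℝ) T := ⟨(τ : ℝ) + h, by linarith [τ.2.1], hlt.le⟩
  have hτu : τ ≤ u := show (τ : ℝ) ≤ τ + h by linarith
  have h1 := (hev hτu).2 le_rfl hlt
  have h2 : walkTime a X (n + 1) ω ≤ u := walkTime_succ_le hX hτu <| by
    rw [abs_of_neg (by linarith)]
    linarith
  have h3 : walkTime a X (n + 1) ω < ⊤ := h2.trans_lt ((lt_top_iff_coe_lt u).2 hlt)
  have h4 := (hev (walkTime_le_succ hX ha n ω)).1 h2
  have h5 := abs_sub_walkTime_succ hX ha h3.ne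
  refine ⟨h3, ?_⟩
  rcases eq_or_eq_neg_of_abs_eq h5 with h | h <;> linarith

theorem walkTime_succ_of_mem_event_neg (hT : 0 ≤ T) (ha : 0 < a) {h : ℝ} (hh : 0 < h)
    {σ : Ω → Set.Icc (0 : ℝ) T} (hσ : σ ω = walkTime a X n ω)
    (hlt : ((walkTime a X n ω : Set.Icc (0 : ℝ) T) : ℝ) + h < T)
    (hω : ω ∈ event hT X σ h a a (-1)) :
    walkTime a X (n + 1) ω < ⊤ ∧
      X (walkTime a X n ω) ω < X (walkTime a X (n + 1) ω) ω := by
  set τ : Set.Icc (0 : ℝ) T := walkTime a X n ω with hτ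
  have hev : ∀ {u : Set.Icc (0 : ℝ) T}, τ ≤ u → _ := fun {u} hu =>
    lt_sub_of_mem_event_neg hT (hX ω) hω (u := u) (hσ ▸ hu)
  simp only [hσ] at hev
  let u : Set.Icc (0 : ℝ) T := ⟨(τ : ℝ) + h, by linarith [τ.2.1], hlt.le⟩
  have hτu : τ ≤ u := show (τ : ℝ) ≤ τ + h by linarith
  have h1 := (hev hτu).2 le_rfl hlt
  have h2 : walkTime a X (n + 1) ω ≤ u := walkTime_succ_le hX hτu <| by
    rw [abs_of_pos (by linarith)]
    linarith
  have h3 : walkTime a X (n + 1) ω < ⊤ := h2.trans_lt ((lt_top_iff_coe_lt u).2 hlt)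
  have h4 := (hev (walkTime_le_succ hX ha n ω)).1 h2
  have h5 := abs_sub_walkTime_succ hX ha h3.ne
  refine ⟨h3, ?_⟩
  rcases eq_or_eq_neg_of_abs_eq h5 with h | h <;> linarith

end

section WalkPrice

variable {ι : Type*} [LinearOrder ι] [BoundedOrder ι]

open Classical in
/-- The exponential of `X` sampled at those of the times `walkTime a X n` that precede the final
time. -/
noncomputable def walkPrice (a : ℝ) (X : ι → Ω → ℝ) : ℕ → Ω → ℝ≥0∞
  | 0, ω => ENNReal.ofReal (Real.exp (X ⊥ ω))
  | n + 1, ω => if walkTime a X (n + 1) ω < ⊤ then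
      ENNReal.ofReal (Real.exp (X (walkTime a X (n + 1) ω) ω)) else walkPrice a X n ω

theorem walkPrice_eq {a : ℝ} {X : ι → Ω → ℝ} {n : ℕ} {ω : Ω} (h : walkTime a X n ω < ⊤) :
    walkPrice a X n ω = ENNReal.ofReal (Real.exp (X (walkTime a X n ω) ω)) := by
  cases n with
  | zero => rfl
  | succ n => rw [walkPrice, if_pos h]

theorem walkPrice_succ_of_not {a : ℝ} {X : ι → Ω → ℝ} {n : ℕ} {ω : Ω}
    (h : ¬ walkTime a X (n + 1) ω < ⊤) : walkPrice a X (n + 1) ω = walkPrice a X n ω := by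
  rw [walkPrice, if_neg h]

variable [TopologicalSpace ι] [OrderTopology ι] [CompactSpace ι]

theorem exists_walkPrice_succ_eq [DenselyOrdered ι] {a : ℝ} {X : ι → Ω → ℝ}
    (hX : ∀ ω, Continuous fun t => X t ω) (ha : 0 < a) {n : ℕ} {ω : Ω}
    (h : walkTime a X n ω < ⊤) :
    ∃ x : ℝ, walkPrice a X (n + 1) ω = ENNReal.ofReal (Real.exp x) ∧
      |x - X (walkTime a X n ω) ω| ≤ a := by
  by_cases h' : walkTime a X (n + 1) ω < ⊤
  · exact ⟨_, walkPrice_eq h', (abs_sub_walkTime_succ hX ha h'.ne).le⟩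
  · exact ⟨_, (walkPrice_succ_of_not h').trans (walkPrice_eq h), by simpa using ha.le⟩

theorem walkPrice_succ_bounds [DenselyOrdered ι] {a : ℝ} {X : ι → Ω → ℝ}
    (hX : ∀ ω, Continuous fun t => X t ω) (ha : 0 < a) {c : ℝ} (hc : Real.exp (2 * a) ≤ c)
    {n : ℕ} {ω : Ω} {t : ι} (h : walkTime a X n ω < ⊤) (h1 : walkTime a X n ω ≤ t)
    (h2 : t ≤ walkTime a X (n + 1) ω) :
    walkPrice a X (n + 1) ω ≤ ENNReal.ofReal c * ENNReal.ofReal (Real.exp (X t ω)) ∧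
      ENNReal.ofReal (Real.exp (X t ω)) ≤ ENNReal.ofReal c * walkPrice a X (n + 1) ω := by
  obtain ⟨x, hx, hxa⟩ := exists_walkPrice_succ_eq hX ha h
  have hta := abs_sub_walkTime_le hX ha h1 h2
  have hc0 : 0 ≤ c := (Real.exp_pos _).le.trans hc
  rw [abs_le] at hxa hta
  have key : ∀ y z : ℝ, y - z ≤ 2 * a →
      ENNReal.ofReal (Real.exp y) ≤ ENNReal.ofReal c * ENNReal.ofReal (Real.exp z) := by
    intro y z hyz
    rw [← ENNReal.ofReal_mul hc0]
    refine ENNReal.ofReal_le_ofReal ?_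
    calc Real.exp y ≤ Real.exp (2 * a + z) := Real.exp_le_exp.2 (by linarith)
      _ = Real.exp (2 * a) * Real.exp z := Real.exp_add _ _
      _ ≤ c * Real.exp z := by gcongr
  rw [hx]
  exact ⟨key _ _ (by linarith), key _ _ (by linarith)⟩

end WalkPrice

end Market

end CPS

open CPS Filter Topology in
theorem theorem1 {Ω : Type*} {m : MeasurableSpace Ω} (P : Measure Ω) [IsProbabilityMeasure P]
    (T : ℝ) (hT : 0 < T)
    (𝓕 : Filtration (Set.Icc (0 : ℝ) T) m)
    (h𝓕₀ : ∀ A : Set Ω, MeasurableSet[𝓕 ⟨0, Set.left_mem_Icc.2 hT.le⟩] A → P A = 0 ∨ P A = 1)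
    (X : Set.Icc (0 : ℝ) T → Ω → ℝ)
    (hX_cont : ∀ ω, Continuous fun t => X t ω)
    (hX_adapted : Adapted 𝓕 X)
    (ε₀ : ℝ) (hε₀ : 0 < ε₀)
    (hF : ∀ h : ℝ, h ∈ Set.Ioo 0 T →
      ∀ (τ : Ω → Set.Icc (0 : ℝ) T)
        (hτ : IsStoppingTime 𝓕 (fun ω => (τ ω : WithTop (Set.Icc (0 : ℝ) T)))),
      (∀ ω, (τ ω : ℝ) < T - h) →
      ∀ j : SignType, ∀ᵐ ω ∂P,
        0 < (P[(CPS.event hT.le X τ h (Real.log (1 + ε₀)) (Real.log (1 + ε₀)) j).indicator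
            (fun _ => (1 : ℝ)) | hτ.measurableSpace]) ω) :
    CPS.AdmitsCPS 𝓕 P ((1 + ε₀) ^ 3 - 1) (fun t ω => Real.exp (X t ω)) := by
  have : Fact ((0 : ℝ) ≤ T) := ⟨hT.le⟩
  set a : ℝ := Real.log (1 + ε₀) with ha_def
  have ha : 0 < a := Real.log_pos (by linarith)
  have hexpa : Real.exp a = 1 + ε₀ := Real.exp_log (by linarith)
  have had : StronglyAdapted 𝓕 X := fun t => (hX_adapted t).stronglyMeasurable
  have hprog := had.isStronglyProgressive_of_continuous hX_cont
  set τ : ℕ → Ω → Set.Icc (0 : ℝ) T := walkTime a X with hτ_def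
  have hτ : ∀ n, IsStoppingTime 𝓕 fun ω => (τ n ω : WithTop (Set.Icc (0 : ℝ) T)) := fun n =>
    isStoppingTime_walkTime hX_cont 𝓕 had n
  have hτmono : ∀ ω, Monotone fun n => τ n ω := fun ω =>
    monotone_nat_of_le_succ fun n => walkTime_le_succ hX_cont ha n ω
  let 𝓖 : Filtration ℕ m :=
    { seq := fun n => (hτ n).measurableSpace
      mono' := fun i j hij => (hτ i).measurableSpace_mono (hτ j) fun ω =>
        WithTop.coe_le_coe.2 (hτmono ω hij)
      le' := fun n => (hτ n).measurableSpace_le }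
  have hXτ : ∀ n, Measurable[𝓖 n] fun ω => X (τ n ω) ω := fun n =>
    measurable_stoppedValue hprog (hτ n)
  set S : ℕ → Set Ω := fun n => {ω | τ n ω < ⊤} with hS_def
  have hS : ∀ n, MeasurableSet[𝓖 n] (S n) := by
    intro n
    have := (hτ n).measurableSet_lt' ⊤
    simpa only [WithTop.coe_lt_coe] using this
  have hSS : ∀ n, S (n + 1) ⊆ S n := fun n ω hω =>
    lt_of_le_of_lt (hτmono ω n.le_succ) hω
  have hXτ' : ∀ n, Measurable[𝓖 (n + 1)] fun ω => X (τ n ω) ω := fun n =>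
    (hXτ n).mono (𝓖.mono n.le_succ) le_rfl
  set U : ℕ → Set Ω := fun n => S (n + 1) ∩ {ω | X (τ n ω) ω < X (τ (n + 1) ω) ω} with hU_def
  set D : ℕ → Set Ω := fun n => S (n + 1) ∩ {ω | X (τ (n + 1) ω) ω < X (τ n ω) ω} with hD_def
  have hstep : ∀ n, ∀ ω ∈ S (n + 1), |X (τ (n + 1) ω) ω - X (τ n ω) ω| = a := fun n ω hω =>
    abs_sub_walkTime_succ hX_cont ha (ne_of_lt hω)
  set L : Ω → ℝ≥0∞ := fun ω => liminf (fun n => walkPrice a X n ω) atTop with hL_def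
  have hMm : ∀ n, Measurable[𝓖 n] (walkPrice a X n) := by
    intro n
    induction n with
    | zero => exact (Real.measurable_exp.comp (hXτ 0)).ennreal_ofReal
    | succ n ih =>
      exact Measurable.ite (hS (n + 1)) (Real.measurable_exp.comp (hXτ (n + 1))).ennreal_ofReal
        (ih.mono (𝓖.mono n.le_succ) le_rfl)
  have hLm : Measurable L := Measurable.liminf fun n => (hMm n).mono (𝓖.le n) le_rfl
  have hLim : ∀ n, ∀ ω ∉ S n, L ω = walkPrice a X n ω := by
    intro n ω hω
    have : ∀ k, n ≤ k → walkPrice a X k ω = walkPrice a X n ω := by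
      intro k hk
      induction k, hk using Nat.le_induction with
      | base => rfl
      | succ k hk ih =>
        rw [walkPrice_succ_of_not, ih]
        exact fun h => hω (lt_of_le_of_lt (hτmono ω (hk.trans k.le_succ)) h)
    have ht : Tendsto (fun k => walkPrice a X k ω) atTop (𝓝 (walkPrice a X n ω)) :=
      tendsto_const_nhds.congr' ((eventually_ge_atTop n).mono fun k hk => (this k hk).symm)
    exact ht.liminf_eq
  have hex : ∀ ω, ∃ n, ω ∉ S n := fun ω =>
    (exists_walkTime_eq_top hX_cont ha ω).imp fun n hn => by
      change ¬ τ n ω < ⊤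
      rw [hτ_def, hn]
      exact lt_irrefl _
  have hpos : ∀ (j : SignType) n (E C : Set Ω), _ → MeasurableSet[𝓖 n] C → C ⊆ S n →
      P (C ∩ E) = 0 → P C = 0 := fun j n E C hE hC hCS h0 =>
    measure_eq_zero_of_event_subset hT (fun h hh σ hσ hlt => hF h hh σ hσ hlt j) (hτ n) hE hC
      (fun ω hω => (lt_top_iff_coe_lt _).1 (hCS hω)) h0
  obtain ⟨Q, hQ, hQP, hPQ, hQM⟩ := exists_walk_measure P 𝓖 S U D hS
    (fun n => (hS (n + 1)).inter (measurableSet_lt (hXτ' n) (hXτ (n + 1))))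
    (fun n => (hS (n + 1)).inter (measurableSet_lt (hXτ (n + 1)) (hXτ' n)))
    (fun n => Set.disjoint_left.2 fun ω h1 h2 =>
      lt_asymm (show X (τ n ω) ω < X (τ (n + 1) ω) ω from h1.2) h2.2)
    (fun n => by
      refine Set.Subset.antisymm (Set.union_subset Set.inter_subset_left Set.inter_subset_left)
        fun ω hω => ?_
      rcases lt_trichotomy (X (τ n ω) ω) (X (τ (n + 1) ω) ω) with h | h | h
      · exact Or.inl ⟨hω, h⟩
      · have := hstep n ω hω
        rw [h, sub_self, abs_zero] at this
        exact absurd this ha.ne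
      · exact Or.inr ⟨hω, h⟩)
    hSS
    (by
      refine Set.eq_empty_iff_forall_notMem.2 fun ω hω => ?_
      obtain ⟨n, hn⟩ := hex ω
      exact hn (Set.mem_iInter.1 hω n))
    (fun n C => hpos (-1) n _ C fun h σ ω hh hσ hlt hω =>
      walkTime_succ_of_mem_event_neg hX_cont hT.le ha hh hσ hlt hω)
    (fun n C => hpos 1 n _ C fun h σ ω hh hσ hlt hω =>
      walkTime_succ_of_mem_event_pos hX_cont hT.le ha hh hσ hlt hω)
    (fun n C => hpos 0 n _ C fun h σ ω hh hσ hlt hω => by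
      refine ⟨(lt_top_iff_coe_lt _).2 (by linarith), ?_⟩
      change ¬ τ (n + 1) ω < ⊤
      rw [hτ_def, walkTime_succ_eq_top_of_mem_event hX_cont hT.le ha hσ hω]
      exact lt_irrefl _)
    (l := ENNReal.ofReal (Real.exp a)) (by simp [Real.exp_pos]) ENNReal.ofReal_ne_top
    (walkPrice a X) L hMm
    (lintegral_ne_top_of_trivial (𝓕.le _) P h𝓕₀
      (Real.measurable_exp.comp (hX_adapted _)).ennreal_ofReal fun _ => ENNReal.ofReal_ne_top)
    (fun n ω hω => by
      rw [walkPrice_eq hω.1, walkPrice_eq (hSS n hω.1), ← ENNReal.ofReal_mul (Real.exp_pos _).le,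
        ← Real.exp_add]
      have h1 := hstep n ω hω.1
      have h2 : X (τ n ω) ω < X (τ (n + 1) ω) ω := hω.2
      rw [abs_of_pos (by linarith)] at h1
      congr 2
      change X (τ (n + 1) ω) ω = X (τ n ω) ω + a
      linarith)
    (fun n ω hω => by
      rw [walkPrice_eq hω.1, walkPrice_eq (hSS n hω.1), ← ENNReal.ofReal_inv_of_pos
        (Real.exp_pos _), ← Real.exp_neg, ← ENNReal.ofReal_mul (Real.exp_pos _).le, ← Real.exp_add]
      have h1 := hstep n ω hω.1
      have h2 : X (τ (n + 1) ω) ω < X (τ n ω) ω := hω.2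
      rw [abs_of_neg (by linarith)] at h1
      congr 2
      change X (τ (n + 1) ω) ω = X (τ n ω) ω + -a
      linarith)
    (fun n ω hω => walkPrice_succ_of_not hω) hLim
  set c : ℝ := 1 + ((1 + ε₀) ^ 3 - 1) with hc_def
  have hc : Real.exp (2 * a) ≤ c := by
    have : Real.exp (2 * a) = (1 + ε₀) ^ 2 := by
      rw [← hexpa, ← Real.exp_nat_mul]
      norm_num
    rw [this, hc_def]
    have := pow_le_pow_right₀ (by linarith : 1 ≤ 1 + ε₀) (by norm_num : 2 ≤ 3)
    linarith
  have hLfin : ∫⁻ ω, L ω ∂Q ≠ ∞ := by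
    have := (hQM 0).2 Set.univ MeasurableSet.univ
    rw [Measure.restrict_univ] at this
    rw [this]
    exact (hQM 0).1
  have hYm : ∀ t, Measurable[𝓕 t] fun ω => Real.exp (X t ω) := fun t =>
    Real.measurable_exp.comp (hX_adapted t)
  have hYm' : ∀ t, Measurable fun ω => ENNReal.ofReal (Real.exp (X t ω)) := fun t =>
    ((hYm t).mono (𝓕.le t) le_rfl).ennreal_ofReal
  have hboth : ∀ t C, MeasurableSet[𝓕 t] C →
      ∫⁻ ω in C, L ω ∂Q
        ≤ ENNReal.ofReal c * ∫⁻ ω in C, ENNReal.ofReal (Real.exp (X t ω)) ∂Q ∧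
      ∫⁻ ω in C, ENNReal.ofReal (Real.exp (X t ω)) ∂Q
        ≤ ENNReal.ofReal c * ∫⁻ ω in C, L ω ∂Q := by
    intro t C hC
    rcases eq_or_lt_of_le (le_top : t ≤ ⊤) with rfl | ht
    · have hpt : ∀ ω, L ω ≤ ENNReal.ofReal c * ENNReal.ofReal (Real.exp (X ⊤ ω)) ∧
          ENNReal.ofReal (Real.exp (X ⊤ ω)) ≤ ENNReal.ofReal c * L ω := by
        intro ω
        obtain ⟨n, hn, hn'⟩ : ∃ n, ω ∈ S n ∧ ω ∉ S (n + 1) := by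
          by_contra! h
          obtain ⟨k, hk⟩ := hex ω
          exact hk (Nat.rec ((lt_top_iff_coe_lt (⊥ : Set.Icc (0 : ℝ) T)).2 hT) h k)
        rw [hLim (n + 1) ω hn']
        exact walkPrice_succ_bounds hX_cont ha hc hn le_top (not_lt.1 hn')
      rw [← lintegral_const_mul _ (hYm' _), ← lintegral_const_mul _ hLm]
      exact ⟨lintegral_mono fun ω => (hpt ω).1, lintegral_mono fun ω => (hpt ω).2⟩
    · set B : ℕ → Set Ω := fun n => (C ∩ {ω | τ n ω ≤ t}) ∩ {ω | t < τ (n + 1) ω} with hB_def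
      have hBm : ∀ n, MeasurableSet[𝓖 (n + 1)] (B n) := by
        intro n
        have h1 : MeasurableSet[𝓕 t] (C ∩ {ω | τ n ω ≤ t}) := by
          have := hC.inter ((hτ n).measurableSet_le t)
          simpa only [WithTop.coe_le_coe] using this
        have := measurableSet_inter_lt_stoppingTime (hτ (n + 1)) h1
        simpa only [WithTop.coe_lt_coe] using this
      have hBm' : ∀ n, MeasurableSet (B n) := fun n => 𝓖.le _ _ (hBm n)
      have hBC : C = ⋃ n, B n := by
        refine Set.Subset.antisymm (fun ω hω => ?_)
          (Set.iUnion_subset fun n ω hω => hω.1.1)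
        obtain ⟨n, hn, hn'⟩ : ∃ n, τ n ω ≤ t ∧ t < τ (n + 1) ω := by
          by_contra! h
          obtain ⟨k, hk⟩ := exists_walkTime_eq_top hX_cont ha ω
          have hk' : τ k ω ≤ t := Nat.rec (motive := fun k => τ k ω ≤ t) bot_le h k
          rw [hτ_def, hk] at hk'
          exact absurd ht (not_lt.2 hk')
        exact Set.mem_iUnion.2 ⟨n, ⟨hω, hn⟩, hn'⟩
      have hBd : Pairwise (Function.onFun Disjoint B) := by
        have hlt : ∀ i j, i < j → Disjoint (B i) (B j) := fun i j hij =>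
          Set.disjoint_left.2 fun ω hi hj =>
            absurd ((show t < τ (i + 1) ω from hi.2).trans_le
              ((hτmono ω (Nat.succ_le_of_lt hij)).trans hj.1.2)) (lt_irrefl _)
        exact fun i j hij => hij.lt_or_gt.elim (hlt i j) fun h => (hlt j i h).symm
      have hbd : ∀ n, ∀ ω ∈ B n, _ := fun n ω hω =>
        walkPrice_succ_bounds hX_cont ha hc (lt_of_le_of_lt hω.1.2 ht) hω.1.2 (le_of_lt hω.2)
      have hMm' : ∀ n, Measurable (walkPrice a X n) := fun n => (hMm n).mono (𝓖.le n) le_rfl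
      rw [hBC, lintegral_iUnion hBm' hBd, lintegral_iUnion hBm' hBd, ← ENNReal.tsum_mul_left,
        ← ENNReal.tsum_mul_left]
      simp_rw [fun n => (hQM (n + 1)).2 (B n) (hBm n)]
      refine ⟨ENNReal.tsum_le_tsum fun n => ?_, ENNReal.tsum_le_tsum fun n => ?_⟩
      · rw [← lintegral_const_mul _ (hYm' _)]
        exact setLIntegral_mono' (hBm' n) fun ω hω => (hbd n ω hω).1
      · rw [← lintegral_const_mul _ (hMm' _)]
        exact setLIntegral_mono' (hBm' n) fun ω hω => (hbd n ω hω).2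
  refine admitsCPS_of_setLIntegral_le hQP hPQ ?_ hYm (fun t ω => Real.exp_pos _) hLm hLfin
    (fun t C hC => (hboth t C hC).1) fun t C hC => (hboth t C hC).2
  have := pow_le_pow_right₀ (by linarith : 1 ≤ 1 + ε₀) (by norm_num : 1 ≤ 3)
  linarith
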